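/- **Setting.** Let $T$ be an arbitrary set and $\mathcal F(T)$ the set of its finite subsets, a semigroup under $\cup$. A real process $X=(X_t)_{t\in T}$ is *simple max-stable* if $\mathbb P(X_t\le x)=e^{-1/x}$ for all $t\in T$, $x>0$, and, for every $n\ge 1$ and independent copies $X^{(1)},\dots,X^{(n)}$ of $X$, the process $\big(\max_{i\le n}X^{(i)}_t\big)_{t\in T}$ has the same law as $(nX_t)_{t\in T}$. Its *extremal coefficient function* (ECF) $\theta$ is given by $\theta(\varnothing)=0$ and, for finite $\varnothing\ne A\subset T$, $$\theta(A)=\lim_{x\to\infty}\frac{\log\mathbb P(\max_{t\in A}X_t\le x)}{\log\mathbb P(X_s\le x)}$$ (where $s\in T$ is arbitrary). For $\psi:\mathcal F(T)\to\mathbb R$ and $K\in\mathcal F(T)$ put $(\Delta_K\psi)(L)=\psi(L)-\psi(L\cup K)$. Call $\psi$ *negative definite* if $\sum_{j,k=1}^n a_ja_k\psi(K_j\cup K_k)\le 0$ for all $n\ge 2$, $K_1,\dots,K_n\in\mathcal F(T)$ and $a_1,\dots,a_n\in\mathbb R$ with $\sum_j a_j=0$; call it *completely alternating* if $(\Delta_{K_1}\cdots\Delta_{K_n}\psi)(K)\le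 0$ for all $n\ge1$ and $K_1,\dots,K_n,K\in\mathcal F(T)$. **Theorem.** Let $\theta:\mathcal F(T)\to\mathbb R$. (a) $\theta$ is the ECF of a simple max-stable process on $T$ if and only if (i) $\theta$ is negative definite, (ii) $\theta(\varnothing)=0$, and (iii) $\theta(\{t\})=1$ for all $t\in T$. Moreover, $\theta$ is negative definite if and only if it is completely alternating. (b) Suppose (i)–(iii) hold. For $M\in\mathcal F(T)$ and $\varnothing\ne L=\{t_1,\dots,t_l\}\subset M$ (with $t_1,\dots,t_l$ distinct) put $$\tau^M_L:=-\Delta_{\{t_1\}}\cdots\Delta_{\{t_l\}}\theta(M\setminus L)=\sum_{I\subset L}(-1)^{|I|+1}\theta\big((M\setminus L)\cup I\big).$$ Then $\tau^M_L\ge0$, and the max-linear distributions on $\mathbb R^M$, $M\in\mathcal F(T)$, given by the laws of $$\Big(\max_{\varnothing\ne L\subset M}\tau^M_L\mathbf 1_{t\in L}Z_L\Big)_{t\in M},\qquad Z_L\ \text{independent with}\ \mathbb P(Z_L\le x)=e^{-1/x}\ (x>0),$$ form a consistent family. They are the finite-dimensional distributions of a process $X^*$ on $T$, unique in law (the Tawn–Molchanov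 process). $X^*$ is simple max-stable, and for every finite $\varnothing\ne M\subset T$ and all $x\in(0,\infty)^M$, $$-\log\mathbb P(X^*_t\le x_t,\ t\in M)=\int\max_{t\in M}\frac{a_t}{x_t}\,H^*_M(da)=\sum_{\varnothing\ne L\subset M}\tau^M_L\max_{t\in L}\frac1{x_t},\qquad H^*_M=\sum_{\varnothing\ne L\subset M}\tau^M_L\|\mathbf 1_L\|\,\delta_{\mathbf 1_L/\|\mathbf 1_L\|},$$ for any norm $\|\cdot\|$ on $\mathbb R^M$, where $\mathbf 1_L\in\mathbb R^M$ is the indicator vector of $L$. The ECF of $X^*$ is $\theta$. -/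

import Mathlib

universe u v

open MeasureTheory ProbabilityTheory Filter Topology

noncomputable section

namespace MaxStable

/-- The unit Fréchet distribution on `ℝ`: the law of `1 / E` for a standard exponential `E`. -/
def unitFrechet : Measure ℝ := (expMeasure 1).map (fun x => x⁻¹)

/-- The distribution function of the unit Fréchet distribution. -/
theorem unitFrechet_real_Iic (x : ℝ) :
    unitFrechet.real (Set.Iic x) = if 0 < x then Real.exp (-1 / x) else 0 := by
  have hp : IsProbabilityMeasure (expMeasure 1) := isProbabilityMeasure_expMeasure one_pos
  have hac : expMeasure 1 ≪ volume := withDensity_absolutelyContinuous _ _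
  have hcdf : ∀ y : ℝ, (expMeasure 1).real (Set.Iic y) =
      if 0 ≤ y then 1 - Real.exp (-y) else 0 := by
    intro y
    have h := cdf_expMeasure_eq one_pos y
    rw [cdf_eq_real] at h
    simpa using h
  have hpos : (expMeasure 1).real (Set.Iic 0) = 0 := by simpa using hcdf 0
  have hpos' : expMeasure 1 (Set.Iic 0) = 0 := by
    simpa [Measure.real, ENNReal.toReal_eq_zero_iff] using hpos
  unfold unitFrechet
  rw [map_measureReal_apply measurable_inv measurableSet_Iic]
  split_ifs with hx
  · have h1 : (expMeasure 1).real ((fun x : ℝ => x⁻¹) ⁻¹' Set.Iic x) =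
        (expMeasure 1).real (Set.Iic x⁻¹)ᶜ := by
      apply measureReal_congr
      have h0 : ∀ᵐ y ∂(expMeasure 1), 0 < y := by
        rw [ae_iff]; simpa [Set.Iic] using hpos'
      have hne : ∀ᵐ y ∂(expMeasure 1), y ≠ x⁻¹ := by
        have : (expMeasure 1) {x⁻¹} = 0 := hac (by simp)
        rw [ae_iff]; simpa using this
      filter_upwards [h0, hne] with y hy hy'
      have : (y⁻¹ ≤ x) = (¬ y ≤ x⁻¹) := by
        rw [inv_le_comm₀ hy hx, not_le]
        exact propext ⟨fun h => lt_of_le_of_ne h (Ne.symm hy'), le_of_lt⟩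
      exact this
    rw [h1, probReal_compl_eq_one_sub measurableSet_Iic, hcdf, if_pos (by positivity)]
    rw [neg_div, one_div]; ring
  · have hsub : (fun x : ℝ => x⁻¹) ⁻¹' Set.Iic x ⊆ Set.Iic 0 := by
      intro y hy
      have : y⁻¹ ≤ x := hy
      exact inv_nonpos.1 (this.trans (not_lt.1 hx))
    rw [Measure.real, measure_mono_null hsub hpos', ENNReal.toReal_zero]

/-- `X = (X t)_{t ∈ T}` is a simple max-stable process on the probability space `(Ω, P)`: the
marginals are unit Fréchet, and for `n ≥ 1` the pointwise maximum of `n` independent copies of `X`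
has the same law (on `T → ℝ` with the product σ-algebra) as `n X`. The independent copies are
realised on the product space `Ωⁿ`. -/
structure IsSimpleMaxStable {T Ω : Type*} [MeasurableSpace Ω] (X : T → Ω → ℝ) (P : Measure Ω) :
    Prop where
  isProbabilityMeasure : IsProbabilityMeasure P
  measurable : ∀ t, Measurable (X t)
  frechet : ∀ t x, P.real {ω | X t ω ≤ x} = if 0 < x then Real.exp (-1 / x) else 0
  maxStable : ∀ n : ℕ, 1 ≤ n →
    (Measure.pi fun _ : Fin n => P).map (fun ω t => ⨆ i, X t (ω i)) =
      P.map (fun ω t => n * X t ω)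

/-- `θ` is the extremal coefficient function of the process `X`. The reference variable `X s`
in the denominator is arbitrary (all marginals coincide for a simple max-stable process). -/
def IsECFOf {T Ω : Type*} [MeasurableSpace Ω] (θ : Finset T → ℝ) (X : T → Ω → ℝ)
    (P : Measure Ω) : Prop :=
  θ ∅ = 0 ∧ ∀ A : Finset T, A.Nonempty → ∀ s : T,
    Tendsto (fun x : ℝ => Real.log (P.real {ω | ∀ t ∈ A, X t ω ≤ x}) /
      Real.log (P.real {ω | X s ω ≤ x})) atTop (𝓝 (θ A))

/-- `θ` is the extremal coefficient function of some simple max-stable process on `T`. -/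
def IsECF {T : Type u} (θ : Finset T → ℝ) : Prop :=
  ∃ (Ω : Type (max u v)) (_ : MeasurableSpace Ω) (P : Measure Ω) (X : T → Ω → ℝ),
    IsSimpleMaxStable X P ∧ IsECFOf θ X P

/-- Negative definiteness on the semigroup `(Finset T, ∪)`. -/
def NegativeDefinite {T : Type*} [DecidableEq T] (ψ : Finset T → ℝ) : Prop :=
  ∀ n : ℕ, 2 ≤ n → ∀ (K : Fin n → Finset T) (a : Fin n → ℝ), ∑ j, a j = 0 →
    ∑ j, ∑ k, a j * a k * ψ (K j ∪ K k) ≤ 0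

/-- The difference operator `(Δ_K f)(L) = f(L) - f(L ∪ K)`. -/
def delta {T : Type*} [DecidableEq T] (K : Finset T) (f : Finset T → ℝ) : Finset T → ℝ :=
  fun L => f L - f (L ∪ K)

/-- `Δ_{K₁} ⋯ Δ_{Kₙ} f` for a list `[K₁, …, Kₙ]`. -/
def iterDelta {T : Type*} [DecidableEq T] (Ks : List (Finset T)) (f : Finset T → ℝ) :
    Finset T → ℝ :=
  Ks.foldr delta f

/-- Complete alternation on the semigroup `(Finset T, ∪)`. -/
def CompletelyAlternating {T : Type*} [DecidableEq T] (ψ : Finset T → ℝ) : Prop :=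
  ∀ Ks : List (Finset T), Ks ≠ [] → ∀ K : Finset T, iterDelta Ks ψ K ≤ 0

/-- The non-empty subsets of `M`. -/
def nonemptySubsets {T : Type*} (M : Finset T) : Finset (Finset T) :=
  {L ∈ M.powerset | L.Nonempty}

/-- The coefficients `τ^M_L = ∑_{I ⊆ L} (-1)^{|I|+1} θ((M \ L) ∪ I)`. -/
def tau {T : Type*} [DecidableEq T] (θ : Finset T → ℝ) (M L : Finset T) : ℝ :=
  ∑ I ∈ L.powerset, (-1) ^ (I.card + 1) * θ ((M \ L) ∪ I)

/-- The max-linear distribution on `ℝ^M` with coefficients `c`: the law of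
`(max_L a_{t,L} Z_L)_{t ∈ M}`, `a_{t,L} = c_L 1_{t ∈ L}`, where `L` runs through the non-empty
subsets of `M` and the `Z_L` are independent unit Fréchet variables. -/
def maxLinearLaw {T : Type*} [DecidableEq T] (c : Finset T → ℝ) (M : Finset T) :
    Measure (M → ℝ) :=
  (Measure.pi fun _ : nonemptySubsets M => unitFrechet).map
    (fun z t => ⨆ L : nonemptySubsets M, (if (t : T) ∈ (L : Finset T) then c L else 0) * z L)

/-- The indicator vector of `L` in `ℝ^M`. -/
def indicatorVec {T : Type*} [DecidableEq T] (M L : Finset T) : M → ℝ :=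
  fun t => if (t : T) ∈ L then 1 else 0

/-- The discrete spectral measure `∑_L c_L ‖1_L‖ δ_{1_L / ‖1_L‖}` on the unit sphere of `ℝ^M`,
with respect to a reference norm `N`; here `L` runs through the non-empty subsets of `M`. -/
def spectralMeasure {T : Type*} [DecidableEq T] (c : Finset T → ℝ) (M : Finset T)
    (N : (M → ℝ) → ℝ) : Measure (M → ℝ) :=
  ∑ L ∈ nonemptySubsets M, ENNReal.ofReal (c L * N (indicatorVec M L)) •
    Measure.dirac ((N (indicatorVec M L))⁻¹ • indicatorVec M L)

/-- `H` is the spectral measure of a random vector with law `Q` on `ℝ^M`: for positive `x`,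
`-log Q(y_t ≤ x_t, t ∈ M) = ∫ max_t (a_t / x_t) H(da)`. -/
def IsSpectralMeasureOf {T : Type*} {M : Finset T} (H Q : Measure (M → ℝ)) : Prop :=
  ∀ x : M → ℝ, (∀ t, 0 < x t) →
    Integrable (fun a : M → ℝ => ⨆ t, a t / x t) H ∧
    Q.real {y | ∀ t, y t ≤ x t} = Real.exp (-∫ a, ⨆ t, a t / x t ∂H)

/-- The family of finite-dimensional laws of the Tawn–Molchanov process of `θ`. -/
def tawnMolchanovLaw {T : Type*} [DecidableEq T] (θ : Finset T → ℝ) (M : Finset T) :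
    Measure (M → ℝ) :=
  maxLinearLaw (tau θ M) M

end MaxStable

end

/-!
Negative definiteness and complete alternation agree because `(Finset T, ∪)` is idempotent. An
iterated difference `Δ = ∑ aᵢ E_{Aᵢ}`, with translations `E_A ψ = ψ (· ∪ A)`, satisfies `Δ Δ = Δ`
and `∑ aᵢ = 0`, so `Δ ψ` is itself a value of the quadratic form of `ψ`. Conversely, Möbius
inversion gives `ψ A = ψ ∅ + ∑ {τ^M_L : L ⊆ M, L ∩ A ≠ ∅}` for `A ⊆ M`
(`sum_tau_inter_nonempty`). Complete alternation makes the weights `τ^M_L` nonnegative, and each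
function `A ↦ 1_{L ∩ A ≠ ∅}` is negative definite, being of the form `1 - u A` with `u`
multiplicative.

An extremal coefficient `θ A` is the limit of `x P(max_A X > x)`, and for each `x` the function
`A ↦ P(max_A X > x)` is negative definite, being the mean of functions of the form `1 - u A` with
`u` a multiplicative indicator. Max-stability is not needed for this direction, only the Fréchet
margins.

For the construction, independence of the `Z_L` yields the joint distribution function
`exp (-∑ τ^M_L max_{t ∈ L} 1 / x_t)` of the max-linear law on positive orthants; on the others it
vanishes, since every `t` is charged by some `τ^M_L > 0`. The recursion
`τ^{M ∪ t}_L + τ^{M ∪ t}_{L ∪ t} = τ^M_L`, in the summed form `sum_tau_mul_inter`, makes these laws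
consistent, and the Kolmogorov extension theorem, proved here for finite measures on Polish spaces
(`IsProjectiveMeasureFamily.exists_isProjectiveLimit`), provides the process. Max-stability, the
Fréchet margins and the extremal coefficients are read off from the distribution function, which is
homogeneous and equals `exp (-θ A / x)` at constant levels.
-/

/-! ### The Kolmogorov extension theorem -/

namespace MeasureTheory

variable {ι : Type*} {α : ι → Type*}

/-- Compactness principle behind the Kolmogorov extension theorem. The limit point is taken along
a free ultrafilter on `ℕ`, coordinate by coordinate, so that the (possibly uncountable) index set
`ι` needs no diagonal argument. -/
theorem nonempty_iInter_cylinder_of_isCompact [∀ i, TopologicalSpace (α i)] [∀ i, T2Space (α i)]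
    (I : ℕ → Finset ι) (K : ∀ n, Set (∀ i : I n, α i)) (hK : ∀ n, IsCompact (K n))
    (h : ∀ n, (⋂ k ≤ n, cylinder (I k) (K k)).Nonempty) :
    (⋂ n, cylinder (I n) (K n)).Nonempty := by
  classical
  choose x hx using h
  have hmem : ∀ n, ∀ᶠ m in (hyperfilter ℕ : Filter ℕ), (I n).restrict (x m) ∈ K n := by
    intro n
    have : ∀ᶠ m in atTop, (I n).restrict (x m) ∈ K n := by
      filter_upwards [eventually_ge_atTop n] with m hm
      exact Set.mem_iInter₂.1 (hx m) n hm
    rw [← Nat.cofinite_eq_atTop] at this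
    exact hyperfilter_le_cofinite this
  have hlim : ∀ n, ∃ z ∈ K n,
      Tendsto (fun m => (I n).restrict (x m)) (hyperfilter ℕ : Filter ℕ) (𝓝 z) := by
    intro n
    exact (hK n).ultrafilter_le_nhds ((hyperfilter ℕ).map fun m => (I n).restrict (x m))
      (le_principal_iff.2 (hmem n))
  choose z hz hzlim using hlim
  have hcoord : ∀ n (t : I n),
      Tendsto (fun m => x m t) (hyperfilter ℕ : Filter ℕ) (𝓝 (z n t)) :=
    fun n t => (tendsto_pi_nhds.1 (hzlim n)) t
  refine ⟨fun t => if ht : ∃ n, t ∈ I n then z ht.choose ⟨t, ht.choose_spec⟩ else x 0 t, ?_⟩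
  refine Set.mem_iInter.2 fun n => ?_
  have : (I n).restrict
      (fun t => if ht : ∃ n, t ∈ I n then z ht.choose ⟨t, ht.choose_spec⟩ else x 0 t) = z n := by
    funext t
    have ht : ∃ n, (t : ι) ∈ I n := ⟨n, t.2⟩
    simp only [Finset.restrict, dif_pos ht]
    exact tendsto_nhds_unique (hcoord ht.choose ⟨t, ht.choose_spec⟩) (hcoord n t)
  rw [mem_cylinder, this]
  exact hz n

variable [∀ i, TopologicalSpace (α i)] [∀ i, PolishSpace (α i)] [∀ i, MeasurableSpace (α i)]
  [∀ i, BorelSpace (α i)] {P : ∀ J : Finset ι, Measure (∀ j : J, α j)} [∀ J, IsFiniteMeasure (P J)]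

/-- The content of a projective family of finite measures on Polish spaces is continuous at `∅`:
approximating the cylinders from inside by cylinders with compact base reduces this to
`nonempty_iInter_cylinder_of_isCompact`. -/
theorem IsProjectiveMeasureFamily.tendsto_projectiveFamilyContent_zero
    (hP : IsProjectiveMeasureFamily P) {s : ℕ → Set (∀ i, α i)}
    (hs : ∀ n, s n ∈ measurableCylinders α) (hanti : Antitone s) (hempty : ⋂ n, s n = ∅) :
    Tendsto (fun n => projectiveFamilyContent hP (s n)) atTop (𝓝 0) := by
  have hmono : Antitone fun n => projectiveFamilyContent hP (s n) := fun m n hmn =>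
    projectiveFamilyContent_mono hP (hs n) (hs m) (hanti hmn)
  have hconv := tendsto_atTop_iInf hmono
  set ε := ⨅ n, projectiveFamilyContent hP (s n) with hε
  have hle : ∀ n, ε ≤ projectiveFamilyContent hP (s n) := fun n => iInf_le _ n
  suffices h0 : ε = 0 by rwa [h0] at hconv
  by_contra hne
  obtain ⟨δ, hδ, hsum⟩ := ENNReal.exists_pos_sum_of_countable' hne ℕ
  choose I S hS hsS using fun n => (mem_measurableCylinders _).1 (hs n)
  have hcomp : ∀ n, ∃ K ⊆ S n, IsCompact K ∧ P (I n) (S n \ K) < δ n := fun n =>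
    (hS n).exists_isCompact_sdiff_lt (measure_ne_top _ _) (hδ n).ne'
  choose K hKS hK hKδ using hcomp
  have hKc : ∀ n, cylinder (I n) (K n) ∈ measurableCylinders α := fun n =>
    cylinder_mem_measurableCylinders _ _ (hK n).measurableSet
  have hdiff : ∀ n, projectiveFamilyContent hP (s n \ cylinder (I n) (K n)) < δ n := by
    intro n
    rw [hsS n, sdiff_cylinder_same, projectiveFamilyContent_cylinder hP
      ((hS n).diff (hK n).measurableSet)]
    exact hKδ n
  have hne' : (⋂ n, cylinder (I n) (K n)).Nonempty := by
    refine nonempty_iInter_cylinder_of_isCompact I K hK fun n => ?_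
    by_contra hemp
    rw [Set.not_nonempty_iff_eq_empty] at hemp
    have hcover : s n ⊆ ⋃ k ∈ Finset.range (n + 1), (s k \ cylinder (I k) (K k)) := by
      intro x hx
      by_contra hx'
      have : x ∈ ⋂ k ≤ n, cylinder (I k) (K k) := by
        refine Set.mem_iInter₂.2 fun k hk => ?_
        by_contra hxk
        exact hx' (Set.mem_biUnion (Finset.mem_coe.2 (Finset.mem_range.2 (Nat.lt_succ_of_le hk)))
          ⟨hanti hk hx, hxk⟩)
      rw [hemp] at this
      exact this
    have hmem : ∀ k, s k \ cylinder (I k) (K k) ∈ measurableCylinders α := fun k =>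
      sdiff_mem_measurableCylinders (hs k) (hKc k)
    have : projectiveFamilyContent hP (s n) ≤ ∑ k ∈ Finset.range (n + 1), δ k :=
      calc projectiveFamilyContent hP (s n)
          ≤ ∑ k ∈ Finset.range (n + 1),
              projectiveFamilyContent hP (s k \ cylinder (I k) (K k)) :=
            (projectiveFamilyContent_mono hP (hs n)
              (isSetRing_measurableCylinders.biUnion_mem _ fun k _ => hmem k) hcover).trans
              (addContent_biUnion_le isSetRing_measurableCylinders fun k _ => hmem k)
        _ ≤ _ := Finset.sum_le_sum fun k _ => (hdiff k).le
    exact absurd (((hle n).trans this).trans (ENNReal.sum_le_tsum _)) (not_le.2 hsum)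
  obtain ⟨x, hx⟩ := hne'
  have : x ∈ ⋂ n, s n := by
    refine Set.mem_iInter.2 fun n => ?_
    rw [hsS n]
    exact hKS n (Set.mem_iInter.1 hx n)
  rw [hempty] at this
  exact this

/-- **Kolmogorov extension theorem** for finite measures on Polish spaces. -/
theorem IsProjectiveMeasureFamily.exists_isProjectiveLimit (hP : IsProjectiveMeasureFamily P) :
    ∃ μ : Measure (∀ i, α i), IsProjectiveLimit μ P := by
  have hsub : (projectiveFamilyContent hP).IsSigmaSubadditive := by
    refine isSigmaSubadditive_of_addContent_iUnion_eq_tsum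
      isSetRing_measurableCylinders fun f hf hf_Union hf' => ?_
    exact addContent_iUnion_eq_sum_of_tendsto_zero isSetRing_measurableCylinders
      (projectiveFamilyContent hP) (fun s hs => projectiveFamilyContent_ne_top _)
      (fun _ => hP.tendsto_projectiveFamilyContent_zero) hf hf_Union hf'
  refine ⟨(projectiveFamilyContent hP).measure isSetSemiring_measurableCylinders
    generateFrom_measurableCylinders.ge hsub, fun I => ?_⟩
  ext s hs
  rw [Measure.map_apply (Finset.measurable_restrict I) hs, AddContent.measure_eq, ← cylinder,
    projectiveFamilyContent_cylinder hP hs]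
  · exact generateFrom_measurableCylinders.symm
  · exact cylinder_mem_measurableCylinders _ _ hs

end MeasureTheory

namespace MaxStable

/-! ### Difference operators and the Möbius coefficients `τ` -/

theorem sum_nonemptySubsets {T : Type*} {f : Finset T → ℝ} (hf : f ∅ = 0) (M : Finset T) :
    ∑ L ∈ nonemptySubsets M, f L = ∑ L ∈ M.powerset, f L := by
  rw [nonemptySubsets]
  refine Finset.sum_filter_of_ne fun L _ hL => ?_
  rw [Finset.nonempty_iff_ne_empty]
  rintro rfl
  exact hL hf

theorem mem_nonemptySubsets {T : Type*} {M L : Finset T} : L ∈ nonemptySubsets M ↔ L ⊆ M ∧ L.Nonempty := by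
  simp [nonemptySubsets]

section Differences

variable {T : Type*} [DecidableEq T]

theorem iterDelta_cons (K : Finset T) (Ks : List (Finset T)) (ψ : Finset T → ℝ) :
    iterDelta (K :: Ks) ψ = delta K (iterDelta Ks ψ) := rfl

theorem delta_comm (K L : Finset T) (ψ : Finset T → ℝ) :
    delta K (delta L ψ) = delta L (delta K ψ) := by
  funext A
  simp only [delta, Finset.union_right_comm A L K]
  ring

/-- Idempotency of `∪` makes the difference operators idempotent. -/
theorem delta_delta_self (K : Finset T) (ψ : Finset T → ℝ) : delta K (delta K ψ) = delta K ψ := by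
  funext A
  simp [delta, Finset.union_assoc]

theorem iterDelta_delta (K : Finset T) (Ks : List (Finset T)) (ψ : Finset T → ℝ) :
    iterDelta Ks (delta K ψ) = delta K (iterDelta Ks ψ) := by
  induction Ks with
  | nil => rfl
  | cons L Ks ih => rw [iterDelta_cons, ih, delta_comm, iterDelta_cons]

theorem iterDelta_iterDelta_self (Ks : List (Finset T)) (ψ : Finset T → ℝ) :
    iterDelta Ks (iterDelta Ks ψ) = iterDelta Ks ψ := by
  induction Ks with
  | nil => rfl
  | cons K Ks ih =>
    rw [iterDelta_cons, iterDelta_cons, iterDelta_delta, delta_delta_self, ih]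

theorem iterDelta_const {Ks : List (Finset T)} (hKs : Ks ≠ []) (c : ℝ) :
    iterDelta Ks (fun _ => c) = 0 := by
  induction Ks with
  | nil => exact absurd rfl hKs
  | cons K Ks ih =>
    rcases eq_or_ne Ks [] with rfl | h
    · funext A
      simp [iterDelta, delta]
    · rw [iterDelta_cons, ih h]
      funext A
      simp [delta]

/-- An iterated difference is a finite linear combination of translations. -/
theorem exists_iterDelta_eq_sum (Ks : List (Finset T)) :
    ∃ (ι : Type) (_ : Fintype ι) (a : ι → ℝ) (A : ι → Finset T),
      ∀ (ψ : Finset T → ℝ) (L : Finset T), iterDelta Ks ψ L = ∑ i, a i * ψ (L ∪ A i) := by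
  induction Ks with
  | nil => exact ⟨Unit, inferInstance, fun _ => 1, fun _ => ∅, fun ψ L => by simp [iterDelta]⟩
  | cons K Ks ih =>
    obtain ⟨ι, _, a, A, h⟩ := ih
    refine ⟨ι ⊕ ι, inferInstance, Sum.elim a (-a), Sum.elim A (fun i => K ∪ A i), fun ψ L => ?_⟩
    rw [iterDelta_cons, delta, h, h, Fintype.sum_sum_type]
    simp [Finset.union_assoc, sub_eq_add_neg]

theorem iterDelta_map_singleton (θ : Finset T → ℝ) {ts : List T} (hts : ts.Nodup) (K : Finset T) :
    iterDelta (ts.map fun t => {t}) θ K =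
      ∑ I ∈ ts.toFinset.powerset, (-1) ^ I.card * θ (K ∪ I) := by
  induction ts generalizing K with
  | nil => simp [iterDelta]
  | cons t ts ih =>
    rw [List.nodup_cons] at hts
    have ht : t ∉ ts.toFinset := by simpa using hts.1
    rw [List.map_cons, iterDelta_cons, delta, ih hts.2, ih hts.2, List.toFinset_cons,
      Finset.sum_powerset_insert ht, sub_eq_add_neg, ← Finset.sum_neg_distrib]
    congr 1
    refine Finset.sum_congr rfl fun I hI => ?_
    have htI : t ∉ I := fun h => ht (Finset.mem_powerset.1 hI h)
    rw [Finset.card_insert_of_notMem htI, Finset.union_assoc, ← Finset.insert_eq]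
    ring

theorem tau_eq_neg_iterDelta (θ : Finset T → ℝ) (M : Finset T) {ts : List T} (hts : ts.Nodup) :
    tau θ M ts.toFinset = -iterDelta (ts.map fun t => {t}) θ (M \ ts.toFinset) := by
  rw [iterDelta_map_singleton θ hts, ← Finset.sum_neg_distrib, tau]
  exact Finset.sum_congr rfl fun I _ => by ring

theorem CompletelyAlternating.tau_nonneg {θ : Finset T → ℝ} (hθ : CompletelyAlternating θ)
    (M : Finset T) {L : Finset T} (hL : L.Nonempty) : 0 ≤ tau θ M L := by
  have h := tau_eq_neg_iterDelta θ M L.nodup_toList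
  rw [Finset.toList_toFinset] at h
  rw [h]
  have : L.toList.map (fun t => ({t} : Finset T)) ≠ [] := by simpa using hL.ne_empty
  linarith [hθ _ this (M \ L)]

theorem tau_empty (θ : Finset T → ℝ) (M : Finset T) : tau θ M ∅ = -θ M := by
  simp [tau]

/-- The Möbius recursion: a new point `t` splits each coefficient into two. -/
theorem tau_insert_add_tau_insert_insert (θ : Finset T → ℝ) {M L : Finset T} {t : T}
    (ht : t ∉ M) (hL : L ⊆ M) :
    tau θ (insert t M) L + tau θ (insert t M) (insert t L) = tau θ M L := by
  have htL : t ∉ L := fun h => ht (hL h)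
  have h1 : insert t M \ L = insert t (M \ L) := Finset.insert_sdiff_of_notMem _ htL
  have h2 : insert t M \ insert t L = M \ L := by
    rw [Finset.insert_sdiff_insert, Finset.sdiff_insert, Finset.erase_eq_of_notMem]
    simp [ht]
  have h3 : ∀ I ∈ L.powerset, (-1 : ℝ) ^ ((insert t I).card + 1) * θ (M \ L ∪ insert t I) =
      -((-1) ^ (I.card + 1) * θ (insert t (M \ L) ∪ I)) := by
    intro I hI
    have htI : t ∉ I := fun h => htL (Finset.mem_powerset.1 hI h)
    rw [Finset.card_insert_of_notMem htI, Finset.union_insert, Finset.insert_union]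
    ring
  simp only [tau, h1, h2, Finset.sum_powerset_insert htL]
  rw [Finset.sum_congr rfl h3, Finset.sum_neg_distrib]
  ring

/-- Consistency of the coefficients: `∑ {τ^M_L : L ∩ S = L'} = τ^S_{L'}` for `L' ⊆ S ⊆ M`, tested
against a function `g` of `L'`. -/
theorem sum_tau_mul_inter (θ : Finset T → ℝ) {S M : Finset T} (hSM : S ⊆ M)
    (g : Finset T → ℝ) :
    ∑ L ∈ M.powerset, tau θ M L * g (L ∩ S) = ∑ L ∈ S.powerset, tau θ S L * g L := by
  suffices h : ∀ B : Finset T, Disjoint B S →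
      ∑ L ∈ (B ∪ S).powerset, tau θ (B ∪ S) L * g (L ∩ S) =
        ∑ L ∈ S.powerset, tau θ S L * g L by
    simpa [Finset.sdiff_union_of_subset hSM] using h (M \ S) Finset.sdiff_disjoint
  intro B
  induction B using Finset.induction_on with
  | empty =>
    intro _
    rw [Finset.empty_union]
    refine Finset.sum_congr rfl fun L hL => ?_
    rw [Finset.inter_eq_left.2 (Finset.mem_powerset.1 hL)]
  | insert t B htB ih =>
    intro hd
    rw [Finset.disjoint_insert_left] at hd
    have ht : t ∉ B ∪ S := by simp [htB, hd.1]
    rw [← ih hd.2, Finset.insert_union, Finset.sum_powerset_insert ht, ← Finset.sum_add_distrib]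
    refine Finset.sum_congr rfl fun L hL => ?_
    rw [Finset.insert_inter_of_notMem hd.1, ← add_mul,
      tau_insert_add_tau_insert_insert θ ht (Finset.mem_powerset.1 hL)]

/-- `θ` is, up to the constant `θ ∅`, the mixture with weights `τ^M_L` of the functions
`A ↦ 1_{L ∩ A ≠ ∅}`. -/
theorem sum_tau_inter_nonempty (θ : Finset T → ℝ) {A M : Finset T} (hA : A ⊆ M) :
    ∑ L ∈ nonemptySubsets M, tau θ M L * (if (L ∩ A).Nonempty then 1 else 0) = θ A - θ ∅ := by
  have hone : ∀ N : Finset T, ∑ L ∈ N.powerset, tau θ N L * (if L = ∅ then 1 else 0) = -θ N := by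
    intro N
    rw [Finset.sum_eq_single_of_mem ∅ (Finset.empty_mem_powerset N) (fun L _ hL => by simp [hL])]
    simp [tau_empty]
  have hA' := sum_tau_mul_inter θ hA (fun L => if L = ∅ then 1 else 0)
  have h0 := sum_tau_mul_inter θ (Finset.empty_subset M) (fun L => if L = ∅ then 1 else 0)
  rw [hone] at hA' h0
  rw [sum_nonemptySubsets (by simp)]
  have : ∀ L ∈ M.powerset, tau θ M L * (if (L ∩ A).Nonempty then (1 : ℝ) else 0) =
      tau θ M L * (if L ∩ ∅ = ∅ then 1 else 0) - tau θ M L * (if L ∩ A = ∅ then 1 else 0) := by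
    intro L _
    rcases (L ∩ A).eq_empty_or_nonempty with h | h
    · simp [h]
    · simp [h, h.ne_empty]
  rw [Finset.sum_congr rfl this, Finset.sum_sub_distrib, h0, hA']
  ring

end Differences

/-! ### Negative definiteness and complete alternation -/

section NegativeDefinite

variable {T : Type*} [DecidableEq T] {ψ : Finset T → ℝ}

theorem NegativeDefinite.sum_nonpos (hψ : NegativeDefinite ψ) {ι : Type*} [Fintype ι]
    (K : ι → Finset T) (a : ι → ℝ) (ha : ∑ i, a i = 0) :
    ∑ i, ∑ j, a i * a j * ψ (K i ∪ K j) ≤ 0 := by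
  rcases le_or_gt (Fintype.card ι) 1 with hc | hc
  · have hs : Subsingleton ι := Fintype.card_le_one_iff_subsingleton.1 hc
    have h0 : ∀ i, a i = 0 := by
      intro i
      rw [← ha, Fintype.sum_subsingleton _ i]
    simp [h0]
  · let e := Fintype.equivFin ι
    have h := hψ _ hc (K ∘ e.symm) (a ∘ e.symm) (by
      rw [← ha]; exact Equiv.sum_comp e.symm a)
    refine le_of_eq_of_le ?_ h
    rw [← Equiv.sum_comp e.symm]
    refine Finset.sum_congr rfl fun i _ => ?_
    rw [← Equiv.sum_comp e.symm]
    rfl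

/-- Writing `Δ = ∑ aᵢ E_{Aᵢ}` with translations `E_A`, idempotency `Δ Δ = Δ` shows that `Δ ψ` is
the quadratic form of `ψ` with the coefficients `aᵢ`, whose sum vanishes. -/
theorem NegativeDefinite.completelyAlternating (hψ : NegativeDefinite ψ) :
    CompletelyAlternating ψ := by
  intro Ks hKs L
  obtain ⟨ι, _, a, A, h⟩ := exists_iterDelta_eq_sum Ks
  have ha : ∑ i, a i = 0 := by
    have := h (fun _ => 1) ∅
    rw [iterDelta_const hKs] at this
    simpa using this.symm
  refine le_of_eq_of_le ?_ (hψ.sum_nonpos (fun i => L ∪ A i) a ha)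
  rw [← iterDelta_iterDelta_self, h]
  refine Finset.sum_congr rfl fun i _ => ?_
  rw [h, Finset.mul_sum]
  refine Finset.sum_congr rfl fun j _ => ?_
  rw [← Finset.union_union_distrib_left, Finset.union_assoc]
  ring

/-- The kernel `1 - u_j u_k` is conditionally negative definite. -/
theorem sum_mul_one_sub_mul_nonpos {ι : Type*} [Fintype ι] (a u : ι → ℝ) (ha : ∑ i, a i = 0) :
    ∑ j, ∑ k, a j * a k * (1 - u j * u k) ≤ 0 := by
  have : ∑ j, ∑ k, a j * a k * (1 - u j * u k) = (∑ j, a j) ^ 2 - (∑ j, a j * u j) ^ 2 := by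
    rw [sq, sq, Finset.sum_mul_sum, Finset.sum_mul_sum, ← Finset.sum_sub_distrib]
    refine Finset.sum_congr rfl fun j _ => ?_
    rw [← Finset.sum_sub_distrib]
    exact Finset.sum_congr rfl fun k _ => by ring
  rw [this, ha]
  nlinarith [sq_nonneg (∑ j, a j * u j)]

theorem CompletelyAlternating.negativeDefinite (hψ : CompletelyAlternating ψ) :
    NegativeDefinite ψ := by
  intro n _ K a ha
  set M := Finset.univ.biUnion K with hM
  have hK : ∀ j, K j ⊆ M := fun j => Finset.subset_biUnion_of_mem K (Finset.mem_univ j)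
  let u : Finset T → Fin n → ℝ := fun L j => if (L ∩ K j).Nonempty then 0 else 1
  have hu : ∀ L j k, (if (L ∩ (K j ∪ K k)).Nonempty then (1 : ℝ) else 0) = 1 - u L j * u L k := by
    intro L j k
    simp only [u, Finset.inter_union_distrib_left, Finset.union_nonempty]
    by_cases h1 : (L ∩ K j).Nonempty <;> by_cases h2 : (L ∩ K k).Nonempty <;> simp [h1, h2]
  have hψ' : ∀ j k, ψ (K j ∪ K k) =
      ψ ∅ + ∑ L ∈ nonemptySubsets M, tau ψ M L * (1 - u L j * u L k) := by
    intro j k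
    have h := sum_tau_inter_nonempty ψ (Finset.union_subset (hK j) (hK k))
    simp only [hu] at h
    rw [h]
    ring
  have hsum : ∑ j, ∑ k, a j * a k * ψ (K j ∪ K k) = ψ ∅ * (∑ j, a j) ^ 2 +
      ∑ L ∈ nonemptySubsets M, tau ψ M L * ∑ j, ∑ k, a j * a k * (1 - u L j * u L k) := by
    have e1 : ψ ∅ * (∑ j, a j) ^ 2 = ∑ j, ∑ k, a j * a k * ψ ∅ := by
      rw [sq, Finset.sum_mul_sum, Finset.mul_sum]
      simp only [Finset.mul_sum]
      exact Finset.sum_congr rfl fun j _ => Finset.sum_congr rfl fun k _ => by ring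
    have e2 : ∑ L ∈ nonemptySubsets M, tau ψ M L * ∑ j, ∑ k, a j * a k * (1 - u L j * u L k) =
        ∑ j, ∑ k, ∑ L ∈ nonemptySubsets M, a j * a k * (tau ψ M L * (1 - u L j * u L k)) := by
      simp only [Finset.mul_sum]
      rw [Finset.sum_comm]
      refine Finset.sum_congr rfl fun j _ => ?_
      rw [Finset.sum_comm]
      exact Finset.sum_congr rfl fun k _ => Finset.sum_congr rfl fun L _ => by ring
    rw [e1, e2, ← Finset.sum_add_distrib]
    refine Finset.sum_congr rfl fun j _ => ?_
    rw [← Finset.sum_add_distrib]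
    refine Finset.sum_congr rfl fun k _ => ?_
    rw [hψ', mul_add, Finset.mul_sum]
  rw [hsum, ha]
  have : ∑ L ∈ nonemptySubsets M, tau ψ M L * ∑ j, ∑ k, a j * a k * (1 - u L j * u L k) ≤ 0 :=
    Finset.sum_nonpos fun L hL => mul_nonpos_of_nonneg_of_nonpos
      (hψ.tau_nonneg M (mem_nonemptySubsets.1 hL).2) (sum_mul_one_sub_mul_nonpos a (u L) ha)
  simpa using this

theorem negativeDefinite_iff_completelyAlternating :
    NegativeDefinite ψ ↔ CompletelyAlternating ψ :=
  ⟨fun h => h.completelyAlternating, fun h => h.negativeDefinite⟩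

end NegativeDefinite

/-! ### Measures on product spaces determined by orthants -/

theorem ext_of_real_orthant {ι : Type*} [Finite ι] {μ ν : Measure (ι → ℝ)}
    [IsProbabilityMeasure μ] [IsProbabilityMeasure ν]
    (h : ∀ x : ι → ℝ, μ.real {y | ∀ t, y t ≤ x t} = ν.real {y | ∀ t, y t ≤ x t}) : μ = ν := by
  have hspan : IsCountablySpanning (Set.range (Set.Iic : ℝ → Set ℝ)) := by
    refine ⟨fun n : ℕ => Set.Iic (n : ℝ), fun n => ⟨n, rfl⟩, ?_⟩
    exact Set.eq_univ_of_forall fun x => Set.mem_iUnion.2 (exists_nat_ge x)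
  refine ext_of_generate_finite
    (Set.pi Set.univ '' Set.pi Set.univ fun _ : ι => Set.range (Set.Iic : ℝ → Set ℝ)) ?_ ?_ ?_
    (by simp)
  · refine (generateFrom_eq_pi (fun _ => ?_) fun _ => hspan).symm
    rw [← borel_eq_generateFrom_Iic, BorelSpace.measurable_eq (α := ℝ)]
  · exact IsPiSystem.pi fun _ => isPiSystem_Iic
  · rintro _ ⟨s, hs, rfl⟩
    choose x hx using fun t => hs t (Set.mem_univ t)
    have : Set.pi Set.univ s = {y | ∀ t, y t ≤ x t} := by
      ext y
      simp [← hx, Set.mem_pi]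
    rw [this]
    exact (measureReal_eq_measureReal_iff).1 (h x)

theorem ext_of_real_forall_mem_le {T : Type*} {μ ν : Measure (T → ℝ)}
    [IsProbabilityMeasure μ] [IsProbabilityMeasure ν]
    (h : ∀ (S : Finset T) (x : T → ℝ),
      μ.real {y | ∀ t ∈ S, y t ≤ x t} = ν.real {y | ∀ t ∈ S, y t ≤ x t}) : μ = ν := by
  classical
  have hprob : ∀ (ρ : Measure (T → ℝ)) [IsProbabilityMeasure ρ] (S : Finset T),
      IsProbabilityMeasure (ρ.map S.restrict) := fun ρ _ S =>
    Measure.isProbabilityMeasure_map (Finset.measurable_restrict S).aemeasurable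
  refine IsProjectiveLimit.unique (P := fun S : Finset T => ν.map S.restrict) (fun S => ?_)
    (fun S => rfl)
  have := hprob μ S
  have := hprob ν S
  refine ext_of_real_orthant fun x => ?_
  have hset : S.restrict ⁻¹' {y : S → ℝ | ∀ t, y t ≤ x t} =
      {y : T → ℝ | ∀ t ∈ S, y t ≤ if ht : t ∈ S then x ⟨t, ht⟩ else 0} := by
    ext y
    simp only [Set.mem_preimage, Set.mem_ofPred_eq, Finset.restrict, Subtype.forall]
    exact forall₂_congr fun t ht => by rw [dif_pos ht]
  have hm : MeasurableSet {y : S → ℝ | ∀ t, y t ≤ x t} := measurableSet_Iic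
  rw [map_measureReal_apply (Finset.measurable_restrict S) hm,
    map_measureReal_apply (Finset.measurable_restrict S) hm, hset, h]

/-! ### Max-linear laws -/

instance isProbabilityMeasure_unitFrechet : IsProbabilityMeasure unitFrechet := by
  have : IsProbabilityMeasure (expMeasure 1) := isProbabilityMeasure_expMeasure one_pos
  exact Measure.isProbabilityMeasure_map measurable_inv.aemeasurable

theorem unitFrechet_real_forall_mul_le {T : Type*} (L : Finset T) {c : ℝ} (hc : 0 ≤ c)
    {x : T → ℝ} (hx : ∀ t ∈ L, 0 < x t) :
    unitFrechet.real {z | ∀ t ∈ L, c * z ≤ x t} = Real.exp (-(c * ⨆ t : L, 1 / x t)) := by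
  rcases hc.eq_or_lt with rfl | hc
  · have : {z : ℝ | ∀ t ∈ L, 0 * z ≤ x t} = Set.univ :=
      Set.eq_univ_of_forall fun z t ht => by rw [zero_mul]; exact (hx t ht).le
    rw [this]
    simp
  rcases L.eq_empty_or_nonempty with rfl | hL
  · simp
  have : Nonempty L := hL.to_subtype
  obtain ⟨s, hs⟩ := exists_eq_ciSup_of_finite (f := fun t : L => 1 / x t)
  have hxs := hx s s.2
  have hset : {z : ℝ | ∀ t ∈ L, c * z ≤ x t} = Set.Iic (x s / c) := by
    ext z
    rw [Set.mem_ofPred_eq, Set.mem_Iic, le_div_iff₀' hc]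
    refine ⟨fun h => h s s.2, fun h t ht => h.trans ?_⟩
    have : 1 / x t ≤ 1 / x s := by
      rw [hs]
      exact le_ciSup (f := fun t : L => 1 / x t) (Set.finite_range _).bddAbove ⟨t, ht⟩
    exact (one_div_le_one_div (hx t ht) hxs).1 this
  rw [hset, unitFrechet_real_Iic, if_pos (by positivity), ← hs]
  congr 1
  field_simp

theorem measurableSet_orthant {T : Type*} {M S : Finset T} (x : T → ℝ) :
    MeasurableSet {y : M → ℝ | ∀ t : M, (t : T) ∈ S → y t ≤ x t} := by
  simp only [Set.ofPred_forall]
  refine MeasurableSet.iInter fun t => MeasurableSet.iInter fun _ => ?_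
  exact measurableSet_le (measurable_pi_apply t) measurable_const

section MaxLinear

variable {T : Type*} [DecidableEq T]

theorem measurable_maxLinear (c : Finset T → ℝ) (M : Finset T) :
    Measurable (fun (z : nonemptySubsets M → ℝ) (t : M) =>
      ⨆ L : nonemptySubsets M, (if (t : T) ∈ (L : Finset T) then c L else 0) * z L) := by
  refine measurable_pi_lambda _ fun t => ?_
  exact Measurable.iSup fun L => (measurable_pi_apply L).const_mul _

instance isProbabilityMeasure_maxLinearLaw (c : Finset T → ℝ) (M : Finset T) :
    IsProbabilityMeasure (maxLinearLaw c M) :=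
  Measure.isProbabilityMeasure_map (measurable_maxLinear c M).aemeasurable

theorem maxLinear_le_iff {c : Finset T → ℝ} {M : Finset T} (z : nonemptySubsets M → ℝ) (t : M)
    (a : ℝ) :
    (⨆ L : nonemptySubsets M, (if (t : T) ∈ (L : Finset T) then c L else 0) * z L) ≤ a ↔
      ∀ L : nonemptySubsets M, (if (t : T) ∈ (L : Finset T) then c L else 0) * z L ≤ a := by
  have : Nonempty (nonemptySubsets M) :=
    ⟨⟨M, mem_nonemptySubsets.2 ⟨subset_rfl, ⟨t, t.2⟩⟩⟩⟩
  exact ciSup_le_iff (Set.finite_range _).bddAbove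

theorem maxLinearLaw_real_orthant {c : Finset T → ℝ} {M S : Finset T}
    (hc : ∀ L ∈ nonemptySubsets M, 0 ≤ c L) (hS : S ⊆ M) {x : T → ℝ} (hx : ∀ t ∈ S, 0 < x t) :
    (maxLinearLaw c M).real {y | ∀ t : M, (t : T) ∈ S → y t ≤ x t} =
      Real.exp (-∑ L ∈ nonemptySubsets M, c L * ⨆ t : (L ∩ S : Finset T), 1 / x t) := by
  rw [maxLinearLaw, map_measureReal_apply (measurable_maxLinear c M) (measurableSet_orthant x)]
  have hset : (fun (z : nonemptySubsets M → ℝ) (t : M) =>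
      ⨆ L : nonemptySubsets M, (if (t : T) ∈ (L : Finset T) then c L else 0) * z L) ⁻¹'
        {y : M → ℝ | ∀ t : M, (t : T) ∈ S → y t ≤ x t} =
      Set.pi Set.univ fun L : nonemptySubsets M =>
        {z : ℝ | ∀ t ∈ (L : Finset T) ∩ S, c L * z ≤ x t} := by
    ext z
    simp only [Set.mem_preimage, Set.mem_ofPred_eq, Set.mem_pi, Set.mem_univ, true_imp_iff,
      maxLinear_le_iff]
    constructor
    · intro h L t ht
      rw [Finset.mem_inter] at ht
      simpa [ht.1] using h ⟨t, hS ht.2⟩ ht.2 L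
    · intro h t ht L
      split_ifs with htL
      · exact h L t (Finset.mem_inter.2 ⟨htL, ht⟩)
      · rw [zero_mul]
        exact (hx t ht).le
  rw [hset, measureReal_def, Measure.pi_pi, ENNReal.toReal_prod, ← Finset.sum_neg_distrib,
    Real.exp_sum, ← Finset.prod_coe_sort (nonemptySubsets M)]
  refine Finset.prod_congr rfl fun L _ => ?_
  exact unitFrechet_real_forall_mul_le _ (hc L L.2) fun t ht => hx t (Finset.mem_inter.1 ht).2

theorem maxLinearLaw_real_orthant_eq_zero {c : Finset T → ℝ} {M S L : Finset T}
    (hL : L ∈ nonemptySubsets M) (hcL : 0 < c L) {x : T → ℝ} {t : T} (htS : t ∈ S) (htL : t ∈ L)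
    (hx : x t ≤ 0) :
    (maxLinearLaw c M).real {y | ∀ t : M, (t : T) ∈ S → y t ≤ x t} = 0 := by
  rw [maxLinearLaw, map_measureReal_apply (measurable_maxLinear c M) (measurableSet_orthant x)]
  have htM : t ∈ M := (mem_nonemptySubsets.1 hL).1 htL
  have hsub : (fun (z : nonemptySubsets M → ℝ) (t : M) =>
      ⨆ L : nonemptySubsets M, (if (t : T) ∈ (L : Finset T) then c L else 0) * z L) ⁻¹'
        {y : M → ℝ | ∀ t : M, (t : T) ∈ S → y t ≤ x t} ⊆
      Function.eval (⟨L, hL⟩ : nonemptySubsets M) ⁻¹' Set.Iic (0 : ℝ) := by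
    intro z hz
    have h := (maxLinear_le_iff z ⟨t, htM⟩ (x t)).1 (hz ⟨t, htM⟩ htS) ⟨L, hL⟩
    simp only [htL, if_true] at h
    exact nonpos_of_mul_nonpos_right (h.trans hx) hcL
  refine le_antisymm ?_ measureReal_nonneg
  refine (measureReal_mono hsub).trans_eq ?_
  rw [(measurePreserving_eval (fun _ : nonemptySubsets M => unitFrechet) ⟨L, hL⟩).measureReal_preimage
    measurableSet_Iic.nullMeasurableSet, unitFrechet_real_Iic, if_neg (lt_irrefl _)]

/-! ### The Tawn–Molchanov laws -/

/-- The joint distribution function of the coordinates in `S` under the Tawn–Molchanov law. It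
does not depend on the ambient finite set. -/
noncomputable def tawnMolchanovCDF (θ : Finset T → ℝ) (S : Finset T) (x : T → ℝ) : ℝ :=
  open Classical in
  if ∀ t ∈ S, 0 < x t then
    Real.exp (-∑ L ∈ nonemptySubsets S, tau θ S L * ⨆ t : L, 1 / x t)
  else 0

variable {θ : Finset T → ℝ}

theorem exists_tau_pos (h0 : θ ∅ = 0) {M : Finset T} {t : T} (h1 : θ {t} = 1) (ht : t ∈ M) :
    ∃ L ∈ nonemptySubsets M, t ∈ L ∧ 0 < tau θ M L := by
  have h := sum_tau_inter_nonempty θ (Finset.singleton_subset_iff.2 ht)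
  rw [h0, h1, sub_zero] at h
  by_contra! hcon
  have : ∑ L ∈ nonemptySubsets M, tau θ M L * (if (L ∩ {t}).Nonempty then (1 : ℝ) else 0) ≤ 0 := by
    refine Finset.sum_nonpos fun L hL => ?_
    split_ifs with hLt
    · obtain ⟨s, hs⟩ := hLt
      rw [Finset.mem_inter, Finset.mem_singleton] at hs
      rw [mul_one]
      exact hcon L hL (hs.2 ▸ hs.1)
    · rw [mul_zero]
  linarith

theorem tawnMolchanovLaw_real_orthant (hθ : CompletelyAlternating θ) (h0 : θ ∅ = 0)
    (h1 : ∀ t, θ {t} = 1) {S M : Finset T} (hS : S ⊆ M) (x : T → ℝ) :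
    (tawnMolchanovLaw θ M).real {y | ∀ t : M, (t : T) ∈ S → y t ≤ x t} =
      tawnMolchanovCDF θ S x := by
  rw [tawnMolchanovLaw, tawnMolchanovCDF]
  split_ifs with hx
  · have hempty : IsEmpty (∅ ∩ S : Finset T) := by
      rw [Finset.empty_inter]
      infer_instance
    rw [maxLinearLaw_real_orthant
      (fun L hL => hθ.tau_nonneg M (mem_nonemptySubsets.1 hL).2) hS hx,
      sum_nonemptySubsets (by rw [Real.iSup_of_isEmpty, mul_zero]),
      sum_nonemptySubsets (by rw [Real.iSup_of_isEmpty, mul_zero]),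
      sum_tau_mul_inter θ hS fun L => ⨆ t : L, 1 / x t]
  · push Not at hx
    obtain ⟨t, htS, hxt⟩ := hx
    obtain ⟨L, hL, htL, hpos⟩ := exists_tau_pos h0 (h1 t) (hS htS)
    exact maxLinearLaw_real_orthant_eq_zero hL hpos htS htL hxt

theorem isProjectiveMeasureFamily_tawnMolchanovLaw (hθ : CompletelyAlternating θ) (h0 : θ ∅ = 0)
    (h1 : ∀ t, θ {t} = 1) :
    IsProjectiveMeasureFamily (α := fun _ : T => ℝ) (tawnMolchanovLaw θ) := by
  intro I J hJI
  have hmeas : Measurable (Finset.restrict₂ (π := fun _ : T => ℝ) hJI) :=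
    Finset.measurable_restrict₂ hJI
  have : IsProbabilityMeasure (tawnMolchanovLaw θ I) := isProbabilityMeasure_maxLinearLaw _ _
  have : IsProbabilityMeasure (tawnMolchanovLaw θ J) := isProbabilityMeasure_maxLinearLaw _ _
  have : IsProbabilityMeasure ((tawnMolchanovLaw θ I).map
      (Finset.restrict₂ (π := fun _ : T => ℝ) hJI)) :=
    Measure.isProbabilityMeasure_map hmeas.aemeasurable
  refine ext_of_real_orthant fun x => ?_
  set x' : T → ℝ := fun t => if ht : t ∈ J then x ⟨t, ht⟩ else 0 with hx'
  have hJ : {y : J → ℝ | ∀ t, y t ≤ x t} = {y : J → ℝ | ∀ t : J, (t : T) ∈ J → y t ≤ x' t} := by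
    ext y
    simp [hx']
  have hI : Finset.restrict₂ (π := fun _ : T => ℝ) hJI ⁻¹' {y : J → ℝ | ∀ t, y t ≤ x t} =
      {y : I → ℝ | ∀ t : I, (t : T) ∈ J → y t ≤ x' t} := by
    ext y
    simp only [Set.mem_preimage, Set.mem_ofPred_eq, Finset.restrict₂, Subtype.forall, hx']
    refine ⟨fun h t _ htJ => ?_, fun h t htJ => ?_⟩
    · rw [dif_pos htJ]
      exact h t htJ
    · simpa [htJ] using h t (hJI htJ) htJ
  have hm : MeasurableSet {y : J → ℝ | ∀ t, y t ≤ x t} := measurableSet_Iic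
  rw [map_measureReal_apply hmeas hm, hI, hJ,
    tawnMolchanovLaw_real_orthant hθ h0 h1 hJI, tawnMolchanovLaw_real_orthant hθ h0 h1 subset_rfl]

theorem real_forall_mem_le_of_isProjectiveLimit (hθ : CompletelyAlternating θ) (h0 : θ ∅ = 0)
    (h1 : ∀ t, θ {t} = 1) {μ : Measure (T → ℝ)} (hμ : IsProjectiveLimit μ (tawnMolchanovLaw θ))
    (S : Finset T) (x : T → ℝ) :
    μ.real {y | ∀ t ∈ S, y t ≤ x t} = tawnMolchanovCDF θ S x := by
  rw [← tawnMolchanovLaw_real_orthant hθ h0 h1 subset_rfl x, ← hμ S,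
    map_measureReal_apply (Finset.measurable_restrict S) (measurableSet_orthant x)]
  congr 1
  ext y
  simp

end MaxLinear

/-! ### Processes with Tawn–Molchanov marginals -/

theorem measurableSet_forall_mem_le {T Ω : Type*} [MeasurableSpace Ω] {X : T → Ω → ℝ}
    (hX : ∀ t, Measurable (X t)) (A : Finset T) (x : T → ℝ) :
    MeasurableSet {ω | ∀ t ∈ A, X t ω ≤ x t} := by
  simp only [Set.ofPred_forall]
  exact Finset.measurableSet_biInter A fun t _ => measurableSet_le (hX t) measurable_const

section TawnMolchanov

variable {T : Type*} [DecidableEq T] {θ : Finset T → ℝ}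

theorem tawnMolchanovCDF_const (h0 : θ ∅ = 0) (A : Finset T) {x : ℝ} (hx : 0 < x) :
    tawnMolchanovCDF θ A (fun _ => x) = Real.exp (-(θ A / x)) := by
  rw [tawnMolchanovCDF, if_pos fun _ _ => hx]
  have h := sum_tau_inter_nonempty θ (subset_refl A)
  rw [h0, sub_zero] at h
  rw [← h, Finset.sum_div]
  congr 2
  refine Finset.sum_congr rfl fun L hL => ?_
  obtain ⟨hLA, hne⟩ := mem_nonemptySubsets.1 hL
  have : Nonempty L := hne.to_subtype
  rw [ciSup_const, Finset.inter_eq_left.2 hLA, if_pos hne]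
  ring

/-- The distribution function is homogeneous, which is max-stability. -/
theorem tawnMolchanovCDF_pow (θ : Finset T → ℝ) (S : Finset T) (x : T → ℝ) {n : ℕ} (hn : 1 ≤ n) :
    tawnMolchanovCDF θ S x ^ n = tawnMolchanovCDF θ S (fun t => x t / n) := by
  have hn' : (0 : ℝ) < n := by exact_mod_cast hn
  have hiff : (∀ t ∈ S, 0 < x t) ↔ ∀ t ∈ S, 0 < x t / n :=
    forall₂_congr fun t _ => (div_pos_iff_of_pos_right hn').symm
  rw [tawnMolchanovCDF, tawnMolchanovCDF]
  by_cases hx : ∀ t ∈ S, 0 < x t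
  · rw [if_pos hx, if_pos (hiff.1 hx), ← Real.exp_nat_mul, mul_neg, Finset.mul_sum]
    congr 2
    refine Finset.sum_congr rfl fun L _ => ?_
    have : ∀ t : L, 1 / (x t / n) = n * (1 / x t) := fun t => by rw [one_div_div, mul_one_div]
    simp only [this]
    rw [← Real.mul_iSup_of_nonneg hn'.le]
    ring
  · rw [if_neg hx, if_neg fun h => hx (hiff.2 h), zero_pow (by omega)]

variable {Ω : Type*} [MeasurableSpace Ω] {P : Measure Ω} {X : T → Ω → ℝ}

theorem isSimpleMaxStable_of_cdf [IsProbabilityMeasure P] (h0 : θ ∅ = 0) (h1 : ∀ t, θ {t} = 1)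
    (hmeas : ∀ t, Measurable (X t))
    (hX : ∀ (S : Finset T) (x : T → ℝ),
      P.real {ω | ∀ t ∈ S, X t ω ≤ x t} = tawnMolchanovCDF θ S x) :
    IsSimpleMaxStable X P where
  isProbabilityMeasure := inferInstance
  measurable := hmeas
  frechet t x := by
    have h := hX {t} fun _ => x
    simp only [Finset.mem_singleton, forall_eq] at h
    rw [h]
    split_ifs with hx
    · rw [tawnMolchanovCDF_const h0 _ hx, h1, neg_div]
    · rw [tawnMolchanovCDF, if_neg (by simpa using hx)]
  maxStable n hn := by
    have hn' : (0 : ℝ) < n := by exact_mod_cast hn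
    have : Nonempty (Fin n) := ⟨⟨0, hn⟩⟩
    have hml : Measurable fun (ω : Fin n → Ω) t => ⨆ i, X t (ω i) :=
      measurable_pi_lambda _ fun t =>
        Measurable.iSup fun i => (hmeas t).comp (measurable_pi_apply i)
    have hmr : Measurable fun ω t => (n : ℝ) * X t ω :=
      measurable_pi_lambda _ fun t => (hmeas t).const_mul _
    have := Measure.isProbabilityMeasure_map (μ := Measure.pi fun _ : Fin n => P) hml.aemeasurable
    have := Measure.isProbabilityMeasure_map (μ := P) hmr.aemeasurable
    refine ext_of_real_forall_mem_le fun S x => ?_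
    have hset : MeasurableSet {y : T → ℝ | ∀ t ∈ S, y t ≤ x t} :=
      measurableSet_forall_mem_le measurable_pi_apply S x
    rw [map_measureReal_apply hml hset, map_measureReal_apply hmr hset]
    have hl : (fun (ω : Fin n → Ω) t => ⨆ i, X t (ω i)) ⁻¹' {y : T → ℝ | ∀ t ∈ S, y t ≤ x t} =
        Set.pi Set.univ fun _ => {ω | ∀ t ∈ S, X t ω ≤ x t} := by
      ext ω
      simp only [Set.mem_preimage, Set.mem_ofPred_eq, Set.mem_pi, Set.mem_univ, true_imp_iff,
        ciSup_le_iff (Set.finite_range _).bddAbove]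
      exact ⟨fun h i t ht => h t ht i, fun h t ht i => h i t ht⟩
    have hr : (fun ω t => (n : ℝ) * X t ω) ⁻¹' {y : T → ℝ | ∀ t ∈ S, y t ≤ x t} =
        {ω | ∀ t ∈ S, X t ω ≤ x t / n} := by
      ext ω
      simp only [Set.mem_preimage, Set.mem_ofPred_eq, le_div_iff₀' hn']
    rw [hl, hr, measureReal_def, Measure.pi_pi, Finset.prod_const, ENNReal.toReal_pow,
      ← measureReal_def, hX, hX S fun t => x t / n, Finset.card_univ, Fintype.card_fin,
      tawnMolchanovCDF_pow θ S x hn]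

theorem isECFOf_of_cdf (h0 : θ ∅ = 0) (h1 : ∀ t, θ {t} = 1)
    (hX : ∀ (S : Finset T) (x : T → ℝ),
      P.real {ω | ∀ t ∈ S, X t ω ≤ x t} = tawnMolchanovCDF θ S x) :
    IsECFOf θ X P := by
  refine ⟨h0, fun A _ s => tendsto_const_nhds.congr' ?_⟩
  filter_upwards [eventually_gt_atTop 0] with x hx
  have hs := hX {s} fun _ => x
  simp only [Finset.mem_singleton, forall_eq] at hs
  rw [hs, hX A fun _ => x, tawnMolchanovCDF_const h0 _ hx, tawnMolchanovCDF_const h0 _ hx,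
    Real.log_exp, Real.log_exp, h1]
  field_simp

end TawnMolchanov

/-! ### The spectral measure -/

section Spectral

variable {T : Type*} [DecidableEq T]

theorem iSup_indicatorVec_div {M L : Finset T} (hL : L.Nonempty) (hLM : L ⊆ M) {x : M → ℝ}
    (hx : ∀ t, 0 < x t) {x' : T → ℝ} (hx' : ∀ t : M, x' t = x t) :
    ⨆ t : M, indicatorVec M L t / x t = ⨆ t : L, 1 / x' t := by
  have : Nonempty L := hL.to_subtype
  have : Nonempty M := (hL.mono hLM).to_subtype
  refine le_antisymm (ciSup_le fun t => ?_) (ciSup_le fun t => ?_)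
  · by_cases ht : (t : T) ∈ L
    · rw [indicatorVec, if_pos ht, ← hx']
      exact le_ciSup (f := fun t : L => 1 / x' t) (Set.finite_range _).bddAbove ⟨t, ht⟩
    · rw [indicatorVec, if_neg ht, zero_div]
      refine Real.iSup_nonneg fun s => ?_
      have := hx ⟨s, hLM s.2⟩
      rw [← hx' ⟨s, hLM s.2⟩] at this
      exact (one_div_pos.2 this).le
  · have h : 1 / x' t = indicatorVec M L ⟨t, hLM t.2⟩ / x ⟨t, hLM t.2⟩ := by
      rw [indicatorVec, if_pos t.2, ← hx']
    rw [h]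
    exact le_ciSup (f := fun t : M => indicatorVec M L t / x t) (Set.finite_range _).bddAbove
      ⟨t, hLM t.2⟩

theorem indicatorVec_ne_zero {M L : Finset T} (hL : L.Nonempty) (hLM : L ⊆ M) :
    indicatorVec M L ≠ 0 := by
  obtain ⟨t, ht⟩ := hL
  intro h
  have := congrFun h ⟨t, hLM ht⟩
  simp [indicatorVec, ht] at this

theorem integrable_spectralMeasure (c : Finset T → ℝ) (M : Finset T) (N : (M → ℝ) → ℝ)
    (f : (M → ℝ) → ℝ) : Integrable f (spectralMeasure c M N) := by
  rw [spectralMeasure, integrable_finsetSum_measure]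
  exact fun L _ => (integrable_dirac (by simp)).smul_measure ENNReal.ofReal_ne_top

/-- The normalisation by `N` cancels because `a ↦ max_t (a_t / x_t)` is homogeneous. -/
theorem integral_spectralMeasure {c : Finset T → ℝ} {M : Finset T}
    (hc : ∀ L ∈ nonemptySubsets M, 0 ≤ c L) (N : Seminorm ℝ (M → ℝ))
    (hN : ∀ a, N a = 0 → a = 0) {x : M → ℝ} (hx : ∀ t, 0 < x t) {x' : T → ℝ}
    (hx' : ∀ t : M, x' t = x t) :
    ∫ a, ⨆ t, a t / x t ∂(spectralMeasure c M N) =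
      ∑ L ∈ nonemptySubsets M, c L * ⨆ t : L, 1 / x' t := by
  rw [spectralMeasure, integral_finsetSum_measure]
  · refine Finset.sum_congr rfl fun L hL => ?_
    obtain ⟨hLM, hne⟩ := mem_nonemptySubsets.1 hL
    have hpos : 0 < N (indicatorVec M L) :=
      (apply_nonneg N _).lt_of_ne fun h => indicatorVec_ne_zero hne hLM (hN _ h.symm)
    rw [integral_smul_measure, integral_dirac,
      ENNReal.toReal_ofReal (mul_nonneg (hc L hL) hpos.le), smul_eq_mul]
    have : ∀ t, ((N (indicatorVec M L))⁻¹ • indicatorVec M L) t / x t =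
        (N (indicatorVec M L))⁻¹ * (indicatorVec M L t / x t) := fun t => by
      rw [Pi.smul_apply, smul_eq_mul, mul_div_assoc]
    simp only [this]
    rw [← Real.mul_iSup_of_nonneg (inv_nonneg.2 hpos.le), iSup_indicatorVec_div hne hLM hx hx']
    field_simp
  · exact fun L _ => (integrable_dirac (by simp)).smul_measure ENNReal.ofReal_ne_top

theorem isSpectralMeasureOf_tawnMolchanovLaw {θ : Finset T → ℝ} (hθ : CompletelyAlternating θ)
    (h0 : θ ∅ = 0) (h1 : ∀ t, θ {t} = 1) (M : Finset T) (N : Seminorm ℝ (M → ℝ))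
    (hN : ∀ a, N a = 0 → a = 0) :
    IsSpectralMeasureOf (spectralMeasure (tau θ M) M N) (tawnMolchanovLaw θ M) := by
  intro x hx
  refine ⟨integrable_spectralMeasure _ _ _ _, ?_⟩
  set x' : T → ℝ := fun t => if ht : t ∈ M then x ⟨t, ht⟩ else 0 with hx'_def
  have hx' : ∀ t : M, x' t = x t := fun t => dif_pos t.2
  rw [integral_spectralMeasure
    (fun L hL => hθ.tau_nonneg M (mem_nonemptySubsets.1 hL).2) N hN hx hx']
  have hset : {y : M → ℝ | ∀ t, y t ≤ x t} = {y : M → ℝ | ∀ t : M, (t : T) ∈ M → y t ≤ x' t} := by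
    ext y
    simp [hx'_def]
  rw [hset, tawnMolchanovLaw_real_orthant hθ h0 h1 subset_rfl, tawnMolchanovCDF, if_pos]
  intro t ht
  rw [hx' ⟨t, ht⟩]
  exact hx _

end Spectral

/-! ### Extremal coefficient functions are negative definite -/

section ECF

variable {T Ω : Type*} [MeasurableSpace Ω] {P : Measure Ω} {X : T → Ω → ℝ} {θ : Finset T → ℝ}

theorem tendsto_real_forall_mem_le [IsProbabilityMeasure P] (A : Finset T) :
    Tendsto (fun x => P.real {ω | ∀ t ∈ A, X t ω ≤ x}) atTop (𝓝 1) := by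
  have hmono : Monotone fun x : ℝ => {ω | ∀ t ∈ A, X t ω ≤ x} :=
    fun x y hxy ω hω t ht => (hω t ht).trans hxy
  have huniv : ⋃ x : ℝ, {ω | ∀ t ∈ A, X t ω ≤ x} = Set.univ := by
    refine Set.eq_univ_of_forall fun ω => Set.mem_iUnion.2 ?_
    obtain ⟨x, hx⟩ := (A.image fun t => X t ω).bddAbove
    exact ⟨x, fun t ht => hx (Finset.mem_coe.2 (Finset.mem_image_of_mem _ ht))⟩
  have h := tendsto_measure_iUnion_atTop (μ := P) hmono
  rw [huniv, measure_univ] at h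
  have h' := (ENNReal.tendsto_toReal ENNReal.one_ne_top).comp h
  rwa [ENNReal.toReal_one] at h'

/-- The extremal coefficient as the normalised probability of exceeding a high level: as the
probability `F` tends to `1`, `-log F` and `1 - F` are asymptotically equivalent. -/
theorem IsECFOf.tendsto_mul_one_sub (hX : IsSimpleMaxStable X P) (hθ : IsECFOf θ X P)
    (A : Finset T) :
    Tendsto (fun x => x * (1 - P.real {ω | ∀ t ∈ A, X t ω ≤ x})) atTop (𝓝 (θ A)) := by
  have := hX.isProbabilityMeasure
  rcases A.eq_empty_or_nonempty with rfl | hA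
  · simp [hθ.1]
  obtain ⟨s, hs⟩ := id hA
  set F : ℝ → ℝ := fun x => P.real {ω | ∀ t ∈ A, X t ω ≤ x} with hF
  have hF1 : Tendsto F atTop (𝓝 1) := tendsto_real_forall_mem_le A
  have hlog : Tendsto (fun x => x * -Real.log (F x)) atTop (𝓝 (θ A)) := by
    refine (hθ.2 A hA s).congr' ?_
    filter_upwards [eventually_gt_atTop 0] with x hx
    rw [hX.frechet, if_pos hx, Real.log_exp]
    simp only [hF]
    field_simp
  have hlow : Tendsto (fun x => F x * (x * -Real.log (F x))) atTop (𝓝 (θ A)) := by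
    simpa using hF1.mul hlog
  have hpos : ∀ᶠ x in atTop, 0 < F x := hF1.eventually (lt_mem_nhds one_pos)
  refine tendsto_of_tendsto_of_tendsto_of_le_of_le' hlow hlog ?_ ?_
  · filter_upwards [hpos, eventually_gt_atTop 0] with x hFx hx
    have h := Real.one_sub_inv_le_log_of_pos hFx
    have h2 : F x * -Real.log (F x) ≤ 1 - F x := by
      have h3 : F x * (1 - (F x)⁻¹) ≤ F x * Real.log (F x) := mul_le_mul_of_nonneg_left h hFx.le
      rw [mul_sub, mul_inv_cancel₀ hFx.ne'] at h3
      linarith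
    calc F x * (x * -Real.log (F x)) = x * (F x * -Real.log (F x)) := by ring
      _ ≤ _ := mul_le_mul_of_nonneg_left h2 hx.le
  · filter_upwards [hpos, eventually_gt_atTop 0] with x hFx hx
    have h := Real.log_le_sub_one_of_pos hFx
    exact mul_le_mul_of_nonneg_left (by linarith) hx.le

theorem IsECFOf.singleton (hX : IsSimpleMaxStable X P) (hθ : IsECFOf θ X P) (t : T) :
    θ {t} = 1 := by
  refine tendsto_nhds_unique (hθ.2 {t} (Finset.singleton_nonempty t) t)
    (tendsto_const_nhds.congr' ?_)
  filter_upwards [eventually_gt_atTop 0] with x hx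
  simp only [Finset.mem_singleton, forall_eq]
  rw [hX.frechet, if_pos hx, Real.log_exp, div_self]
  exact div_ne_zero (by norm_num) hx.ne'

theorem sum_mul_real_inter_nonneg [IsFiniteMeasure P] {ι : Type*} [Fintype ι] (a : ι → ℝ)
    {E : ι → Set Ω} (hE : ∀ j, MeasurableSet (E j)) :
    0 ≤ ∑ j, ∑ k, a j * a k * P.real (E j ∩ E k) := by
  have hint : ∀ j k, Integrable ((E j ∩ E k).indicator fun _ => a j * a k) P := fun j k =>
    (integrable_const _).indicator ((hE j).inter (hE k))
  have : ∑ j, ∑ k, a j * a k * P.real (E j ∩ E k) =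
      ∫ ω, (∑ j, (E j).indicator (fun _ => a j) ω) ^ 2 ∂P := by
    have hsq : ∀ ω, (∑ j, (E j).indicator (fun _ => a j) ω) ^ 2 =
        ∑ j, ∑ k, (E j ∩ E k).indicator (fun _ => a j * a k) ω := by
      intro ω
      rw [sq, Finset.sum_mul_sum]
      refine Finset.sum_congr rfl fun j _ => Finset.sum_congr rfl fun k _ => ?_
      rw [← Set.inter_indicator_mul]
    simp only [hsq]
    rw [integral_finsetSum _ fun j _ => integrable_finsetSum _ fun k _ => hint j k]
    refine Finset.sum_congr rfl fun j _ => ?_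
    rw [integral_finsetSum _ fun k _ => hint j k]
    refine Finset.sum_congr rfl fun k _ => ?_
    rw [integral_indicator_const _ ((hE j).inter (hE k)), smul_eq_mul, mul_comm]
  rw [this]
  exact integral_nonneg fun ω => sq_nonneg _

theorem IsECFOf.negativeDefinite [DecidableEq T] (hX : IsSimpleMaxStable X P)
    (hθ : IsECFOf θ X P) : NegativeDefinite θ := by
  have := hX.isProbabilityMeasure
  intro n _ K a ha
  have hlim : Tendsto (fun x => ∑ j, ∑ k, a j * a k *
      (x * (1 - P.real {ω | ∀ t ∈ K j ∪ K k, X t ω ≤ x}))) atTop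
      (𝓝 (∑ j, ∑ k, a j * a k * θ (K j ∪ K k))) :=
    tendsto_finsetSum _ fun j _ => tendsto_finsetSum _ fun k _ =>
      (hθ.tendsto_mul_one_sub hX (K j ∪ K k)).const_mul _
  refine le_of_tendsto hlim ?_
  filter_upwards [eventually_gt_atTop 0] with x hx
  set E : Fin n → Set Ω := fun j => {ω | ∀ t ∈ K j, X t ω ≤ x} with hE
  have hEm : ∀ j, MeasurableSet (E j) := fun j =>
    measurableSet_forall_mem_le hX.measurable (K j) fun _ => x
  have hinter : ∀ j k, {ω | ∀ t ∈ K j ∪ K k, X t ω ≤ x} = E j ∩ E k := by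
    intro j k
    ext ω
    simp only [hE, Set.mem_ofPred_eq, Set.mem_inter_iff, Finset.mem_union, or_imp, forall_and]
  have hsum : ∑ j, ∑ k, a j * a k * (x * (1 - P.real {ω | ∀ t ∈ K j ∪ K k, X t ω ≤ x})) =
      x * ((∑ j, a j) ^ 2 - ∑ j, ∑ k, a j * a k * P.real (E j ∩ E k)) := by
    rw [sq, Finset.sum_mul_sum, ← Finset.sum_sub_distrib, Finset.mul_sum]
    refine Finset.sum_congr rfl fun j _ => ?_
    rw [← Finset.sum_sub_distrib, Finset.mul_sum]
    refine Finset.sum_congr rfl fun k _ => ?_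
    rw [hinter]
    ring
  rw [hsum, ha]
  have := sum_mul_real_inter_nonneg (P := P) a hEm
  exact mul_nonpos_of_nonneg_of_nonpos hx.le (by linarith)

end ECF

theorem exists_isProjectiveLimit_tawnMolchanovLaw {T : Type*} [DecidableEq T] {θ : Finset T → ℝ}
    (hθ : CompletelyAlternating θ) (h0 : θ ∅ = 0) (h1 : ∀ t, θ {t} = 1) :
    ∃ μ : Measure (T → ℝ), IsProbabilityMeasure μ ∧
      IsProjectiveLimit μ (tawnMolchanovLaw θ) := by
  have hp : ∀ M, IsProbabilityMeasure (tawnMolchanovLaw θ M) :=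
    fun M => isProbabilityMeasure_maxLinearLaw _ _
  obtain ⟨μ, hμ⟩ :=
    (isProjectiveMeasureFamily_tawnMolchanovLaw hθ h0 h1).exists_isProjectiveLimit
  exact ⟨μ, hμ.isProbabilityMeasure, hμ⟩

/-- The Tawn–Molchanov process lives on `T → ℝ`; `ULift` moves it to the required universe. -/
theorem isECF_of_completelyAlternating {T : Type u} [DecidableEq T] {θ : Finset T → ℝ}
    (hθ : CompletelyAlternating θ) (h0 : θ ∅ = 0) (h1 : ∀ t, θ {t} = 1) : IsECF.{u, v} θ := by
  obtain ⟨μ, hμp, hμ⟩ := exists_isProjectiveLimit_tawnMolchanovLaw hθ h0 h1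
  have hup : Measurable (ULift.up.{v} : (T → ℝ) → ULift.{v} (T → ℝ)) := measurable_up
  have hprob := Measure.isProbabilityMeasure_map (μ := μ) hup.aemeasurable
  have hmeas : ∀ t : T, Measurable fun ω : ULift.{v} (T → ℝ) => ω.down t := fun t =>
    (measurable_pi_apply t).comp measurable_down
  have hcdf : ∀ (S : Finset T) (x : T → ℝ), (μ.map ULift.up.{v}).real
      {ω : ULift.{v} (T → ℝ) | ∀ t ∈ S, ω.down t ≤ x t} = tawnMolchanovCDF θ S x := by
    intro S x
    rw [← real_forall_mem_le_of_isProjectiveLimit hθ h0 h1 hμ, map_measureReal_apply hup]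
    · rfl
    · exact measurableSet_forall_mem_le hmeas S x
  exact ⟨ULift.{v} (T → ℝ), inferInstance, μ.map ULift.up.{v}, fun t ω => ω.down t,
    isSimpleMaxStable_of_cdf h0 h1 hmeas hcdf, isECFOf_of_cdf h0 h1 hcdf⟩

end MaxStable

open MaxStable in
theorem theorem1 {T : Type u} [DecidableEq T] (θ : Finset T → ℝ) :
    -- characterisation of extremal coefficient functions
    (IsECF.{u, v} θ ↔ NegativeDefinite θ ∧ θ ∅ = 0 ∧ ∀ t : T, θ {t} = 1) ∧
    -- negative definiteness is the same as complete alternation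
    (NegativeDefinite θ ↔ CompletelyAlternating θ) ∧
    -- the Tawn–Molchanov process
    (NegativeDefinite θ → θ ∅ = 0 → (∀ t : T, θ {t} = 1) →
      (∀ M L : Finset T, L.Nonempty → L ⊆ M →
        (∀ ts : List T, ts.Nodup → ts.toFinset = L →
          tau θ M L = -iterDelta (ts.map fun t => {t}) θ (M \ L)) ∧
        0 ≤ tau θ M L) ∧
      IsProjectiveMeasureFamily (α := fun _ : T => ℝ) (tawnMolchanovLaw θ) ∧
      ∃ μ : Measure (T → ℝ), IsProjectiveLimit μ (tawnMolchanovLaw θ) ∧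
        (∀ ν : Measure (T → ℝ), IsProjectiveLimit ν (tawnMolchanovLaw θ) → ν = μ) ∧
        IsSimpleMaxStable (fun (t : T) (x : T → ℝ) => x t) μ ∧
        (∀ M : Finset T, M.Nonempty → ∀ N : Seminorm ℝ (M → ℝ), (∀ a, N a = 0 → a = 0) →
          IsSpectralMeasureOf (spectralMeasure (tau θ M) M N) (μ.map M.restrict)) ∧
        (∀ M : Finset T, M.Nonempty → ∀ x : T → ℝ, (∀ t ∈ M, 0 < x t) →
          μ.real {y | ∀ t ∈ M, y t ≤ x t} =
            Real.exp (-∑ L ∈ nonemptySubsets M, tau θ M L * ⨆ t : L, 1 / x t)) ∧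
        IsECFOf θ (fun (t : T) (x : T → ℝ) => x t) μ) := by
  refine ⟨⟨?_, ?_⟩, negativeDefinite_iff_completelyAlternating, ?_⟩
  · rintro ⟨Ω, _, P, X, hX, hθ⟩
    exact ⟨hθ.negativeDefinite hX, hθ.1, hθ.singleton hX⟩
  · rintro ⟨hθ, h0, h1⟩
    exact isECF_of_completelyAlternating hθ.completelyAlternating h0 h1
  · intro hneg h0 h1
    have hθ := hneg.completelyAlternating
    obtain ⟨μ, _, hμ⟩ := exists_isProjectiveLimit_tawnMolchanovLaw hθ h0 h1
    have hcdf := real_forall_mem_le_of_isProjectiveLimit hθ h0 h1 hμ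
    have hp : ∀ M, IsProbabilityMeasure (tawnMolchanovLaw θ M) :=
      fun M => isProbabilityMeasure_maxLinearLaw _ _
    refine ⟨fun M L hL _ => ⟨?_, hθ.tau_nonneg M hL⟩,
      isProjectiveMeasureFamily_tawnMolchanovLaw hθ h0 h1, μ, hμ, fun ν hν => hν.unique hμ,
      isSimpleMaxStable_of_cdf h0 h1 measurable_pi_apply hcdf, fun M _ N hN => ?_,
      fun M _ x hx => ?_, isECFOf_of_cdf h0 h1 hcdf⟩
    · rintro ts hts rfl
      exact tau_eq_neg_iterDelta θ M hts
    · rw [hμ M]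
      exact isSpectralMeasureOf_tawnMolchanovLaw hθ h0 h1 M N hN
    · rw [hcdf, tawnMolchanovCDF, if_pos hx]
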